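/- Let $G$ be a Polish group (not necessarily abelian) with Borel $\sigma$-algebra $\mathcal{B}_G$ and identity $e$. Let $\mathcal{Y}$ be the set of all cosets $gH$ of finite normal subgroups $H \lhd G$, with the $\sigma$-algebra generated by the maps $S \mapsto |B \cap S|$, $B \in \mathcal{B}_G$. A pair $(X, Y)$ of a $G$-valued random variable $X$ and a $\mathcal{Y}$-valued random variable $Y$ is said to follow an erasure distribution if for every $B \in \mathcal{B}_G$, $$P_{X|Y}(B) = \frac{|B \cap Y|}{|Y|} \quad \text{a.s.},$$ where $P_{X|Y}$ is the regular conditional distribution of $X$ given $Y$. Two random variables $Y$ and $Z$ are equivalent relative to $X$, written $Y \equiv_X Z$, if $P_{X|Y}(B) = P_{X|Z}(B)$ a.s. for every measurable $B$. For $g \in G$, $aH, bK \in \mathcal{Y}$ put $\phi(g, aH, bK) = (a^{-1} g H) \cap (bK) \in \mathcal{Y} \cup \{\emptyset\}$. Let $(X_i, Y_i)$, $i \ge 1$, be mutually independent pairs, each following an erasure distribution. Put $U_0^{(i)} = X_i$ and $Y_0^{(i)} = Y_i$ for $i \ge 1$, and for $n \ge 1$, $m \ge 0$ and $1 \le l \le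 2^{n-1}$, with $a = m 2^n + l$ and $b = a + 2^{n-1}$, $$U_n^{(m2^n + 2l-1)} = U_{n-1}^{(a)}\, U_{n-1}^{(b)}, \qquad U_n^{(m2^n + 2l)} = U_{n-1}^{(b)},$$ $$Y_n^{(m2^n + 2l-1)} = Y_{n-1}^{(a)}\, Y_{n-1}^{(b)}, \qquad Y_n^{(m2^n + 2l)} = \phi\big(U_n^{(m2^n+2l-1)}, Y_{n-1}^{(a)}, Y_{n-1}^{(b)}\big),$$ where the last value is replaced by $\{e\}$ if it is empty. Then for all $n \ge 0$ and $i \ge 1$, the pair $(U_n^{(i)}, Y_n^{(i)})$ follows an erasure distribution, and with $m = \lfloor (i-1)/2^n \rfloor$, $$Y_n^{(i)} \equiv_{U_n^{(i)}} \Big( \{U_n^{(j)}\}_{j = m2^n+1}^{i-1},\ \{Y_j\}_{j = m2^n+1}^{(m+1)2^n} \Big).$$ -/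

import Mathlib

open MeasureTheory ProbabilityTheory
open scoped Pointwise ENNReal

namespace PolarErasure

/-- `S` is a coset `g • H` of a finite normal subgroup `H` of `G`. -/
def IsFiniteCoset {G : Type*} [Group G] (S : Set G) : Prop :=
  ∃ (g : G) (H : Subgroup G), H.Normal ∧ (H : Set G).Finite ∧ S = g • (H : Set G)

/-- The alphabet `𝒴` of all cosets of finite normal subgroups of `G`. -/
@[ext]
structure FiniteCoset (G : Type*) [Group G] where
  carrier : Set G
  isFiniteCoset : IsFiniteCoset carrier

/-- The σ-algebra on the alphabet `𝒴`: the smallest one for which all the counts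
`S ↦ |B ∩ S|`, `B` Borel, are measurable.  When `G` is countable it is the discrete one; for Polish
`G` it is the trace of the Effros Borel structure on the closed subsets of `G`. -/
noncomputable instance FiniteCoset.instMeasurableSpace {G : Type*} [Group G] [MeasurableSpace G] :
    MeasurableSpace (FiniteCoset G) :=
  ⨆ B : {B : Set G // MeasurableSet B},
    MeasurableSpace.comap (fun S : FiniteCoset G => (B.1 ∩ S.carrier).ncard) ⊤

theorem isFiniteCoset_one {G : Type*} [Group G] : IsFiniteCoset ({1} : Set G) :=
  ⟨1, ⊥, inferInstance, by simp, by simp⟩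

theorem mem_coset_iff {G : Type*} [Group G] {a x : G} {H : Subgroup G} :
    x ∈ a • (H : Set G) ↔ a⁻¹ * x ∈ H := by
  rw [Set.mem_smul_set_iff_inv_smul_mem]; rfl

theorem IsFiniteCoset.mul {G : Type*} [Group G] {S T : Set G}
    (hS : IsFiniteCoset S) (hT : IsFiniteCoset T) : IsFiniteCoset (S * T) := by
  obtain ⟨a, H, hH, hHf, rfl⟩ := hS
  obtain ⟨b, K, hK, hKf, rfl⟩ := hT
  refine ⟨a * b, H ⊔ K, inferInstance, ?_, ?_⟩
  · rw [Subgroup.mul_normal]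
    exact hHf.mul hKf
  · rw [Subgroup.mul_normal]
    ext x
    constructor
    · rintro ⟨_, ⟨h, hh, rfl⟩, _, ⟨k, hk, rfl⟩, rfl⟩
      refine ⟨(b⁻¹ * h * b) * k, ⟨b⁻¹ * h * b, ?_, k, hk, rfl⟩, ?_⟩
      · simpa using hH.conj_mem h hh b⁻¹
      · simp [mul_assoc]
    · rintro ⟨_, ⟨h, hh, k, hk, rfl⟩, rfl⟩
      refine ⟨a * (b * h * b⁻¹), ⟨b * h * b⁻¹, hH.conj_mem h hh b, rfl⟩, b * k, ⟨k, hk, rfl⟩, ?_⟩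
      simp [mul_assoc]

/-- The product of two cosets. -/
def FiniteCoset.minus {G : Type*} [Group G] (S T : FiniteCoset G) : FiniteCoset G :=
  ⟨S.carrier * T.carrier, S.isFiniteCoset.mul T.isFiniteCoset⟩

/-- The map `φ (g, a • H, b • K) = (a⁻¹ • g • H) ∩ (b • K)`, written without a choice of
representatives; `phi_coset` below is the formula with representatives. -/
def phi {G : Type*} [Group G] (g : G) (S T : FiniteCoset G) : Set G :=
  (S.carrier⁻¹ * {g}) ∩ T.carrier

theorem phi_coset {G : Type*} [Group G] (g a b : G) (H K : Subgroup G) (hH : H.Normal)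
    (S T : FiniteCoset G) (hS : S.carrier = a • (H : Set G)) (hT : T.carrier = b • (K : Set G)) :
    phi g S T = ((a⁻¹ * g) • (H : Set G)) ∩ (b • (K : Set G)) := by
  unfold phi
  rw [hS, hT]
  congr 1
  ext x
  rw [mem_coset_iff, Set.mul_singleton, Set.mem_image]
  constructor
  · rintro ⟨y, hy, rfl⟩
    rw [Set.mem_inv, mem_coset_iff] at hy
    have h1 := H.inv_mem hy
    have h2 := hH.conj_mem _ h1 (g⁻¹ * a)
    have e : g⁻¹ * a * (a⁻¹ * y⁻¹)⁻¹ * (g⁻¹ * a)⁻¹ = (a⁻¹ * g)⁻¹ * (y * g) := by group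
    rwa [e] at h2
  · intro hx
    refine ⟨x * g⁻¹, ?_, by simp⟩
    rw [Set.mem_inv, mem_coset_iff]
    have h1 := hH.conj_mem _ (H.inv_mem hx) (a⁻¹ * g)
    have e : a⁻¹ * g * ((a⁻¹ * g)⁻¹ * x)⁻¹ * (a⁻¹ * g)⁻¹ = a⁻¹ * (x * g⁻¹)⁻¹ := by group
    rwa [e] at h1

theorem isFiniteCoset_phi {G : Type*} [Group G] (g : G) (S T : FiniteCoset G)
    (h : (phi g S T).Nonempty) : IsFiniteCoset (phi g S T) := by
  obtain ⟨a, H, hH, hHf, hS⟩ := S.isFiniteCoset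
  obtain ⟨b, K, hK, hKf, hT⟩ := T.isFiniteCoset
  have e := phi_coset g a b H K hH S T hS hT
  rw [e] at h ⊢
  obtain ⟨x, hx1, hx2⟩ := h
  refine ⟨x, H ⊓ K, inferInstance, hHf.subset (fun y hy => hy.1), ?_⟩
  rw [mem_coset_iff] at hx1 hx2
  ext y
  simp only [Set.mem_inter_iff, mem_coset_iff, Subgroup.mem_inf]
  have e1 : (a⁻¹ * g)⁻¹ * y = ((a⁻¹ * g)⁻¹ * x) * (x⁻¹ * y) := by group
  have e2 : b⁻¹ * y = (b⁻¹ * x) * (x⁻¹ * y) := by group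
  rw [e1, e2, H.mul_mem_cancel_left hx1, K.mul_mem_cancel_left hx2]

open Classical in
/-- The value of `φ`, replaced by the trivial subgroup `{1}` where `φ` is empty. -/
noncomputable def FiniteCoset.plus {G : Type*} [Group G] (g : G) (S T : FiniteCoset G) :
    FiniteCoset G :=
  if h : (phi g S T).Nonempty then ⟨phi g S T, isFiniteCoset_phi g S T h⟩
  else ⟨{1}, isFiniteCoset_one⟩

/-- `Y` and `Z` are equivalent relative to `X`: the regular conditional distributions of `X` given
`Y` and of `X` given `Z` agree almost surely on every measurable set. -/
structure CondEquiv {Ω 𝓧 𝓨 𝓩 : Type*} [MeasurableSpace Ω]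
    [MeasurableSpace 𝓧] [StandardBorelSpace 𝓧] [Nonempty 𝓧] [MeasurableSpace 𝓨] [MeasurableSpace 𝓩]
    (μ : Measure Ω) [IsFiniteMeasure μ] (X : Ω → 𝓧) (Y : Ω → 𝓨) (Z : Ω → 𝓩) : Prop where
  measurable_source : Measurable X
  measurable_left : Measurable Y
  measurable_right : Measurable Z
  condDistrib_eq : ∀ B : Set 𝓧, MeasurableSet B →
    ∀ᵐ ω ∂μ, condDistrib X Y μ (Y ω) B = condDistrib X Z μ (Z ω) B

/-- `(X, Y)` follows an erasure distribution: given `Y`, the variable `X` is uniform on the finite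
coset `Y`. -/
structure IsErasure {Ω G : Type*} [MeasurableSpace Ω] [Group G] [MeasurableSpace G]
    [StandardBorelSpace G]
    (μ : Measure Ω) [IsFiniteMeasure μ] (X : Ω → G) (Y : Ω → FiniteCoset G) : Prop where
  measurable_source : Measurable X
  measurable_side : Measurable Y
  condDistrib_eq : ∀ B : Set G, MeasurableSet B →
    ∀ᵐ ω ∂μ, condDistrib X Y μ (Y ω) B =
      ((B ∩ (Y ω).carrier).ncard : ℝ≥0∞) / ((Y ω).carrier.ncard : ℝ≥0∞)

/-- The positive integers are cut into the blocks `m * 2 ^ n + 1, …, (m + 1) * 2 ^ n`;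
`blockIndex n i` is the number `m` of the block that contains `i ≥ 1`. -/
def blockIndex (n i : ℕ) : ℕ := (i - 1) / 2 ^ n

/-- For `i = m * 2 ^ n + (2 * l - 1)` or `i = m * 2 ^ n + 2 * l` with `1 ≤ l ≤ 2 ^ (n - 1)`, this is
`m * 2 ^ n + l` (see the two lemmas below). -/
def upperIndex (n i : ℕ) : ℕ :=
  blockIndex n i * 2 ^ n + (i - blockIndex n i * 2 ^ n + 1) / 2

theorem upperIndex_odd (n m l : ℕ) (h1 : 1 ≤ l) (h2 : l ≤ 2 ^ n) :
    upperIndex (n + 1) (m * 2 ^ (n + 1) + (2 * l - 1)) = m * 2 ^ (n + 1) + l := by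
  have hb : blockIndex (n + 1) (m * 2 ^ (n + 1) + (2 * l - 1)) = m := by
    unfold blockIndex
    have : (2 : ℕ) ^ (n + 1) = 2 * 2 ^ n := by ring
    apply Nat.div_eq_of_lt_le
    · omega
    · rw [add_mul]; omega
  unfold upperIndex
  rw [hb]
  omega

theorem upperIndex_even (n m l : ℕ) (h1 : 1 ≤ l) (h2 : l ≤ 2 ^ n) :
    upperIndex (n + 1) (m * 2 ^ (n + 1) + 2 * l) = m * 2 ^ (n + 1) + l := by
  have hb : blockIndex (n + 1) (m * 2 ^ (n + 1) + 2 * l) = m := by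
    unfold blockIndex
    have : (2 : ℕ) ^ (n + 1) = 2 * 2 ^ n := by ring
    apply Nat.div_eq_of_lt_le
    · omega
    · rw [add_mul]; omega
  unfold upperIndex
  rw [hb]
  omega

/-- The recursive polar transform of the sequence `X 1, X 2, …` (the value at index `0` is unused):
`U₀⁽ⁱ⁾ = Xᵢ`, and, in each block of length `2 ^ n`,
`Uₙ⁽²ˡ⁻¹⁾ = Uₙ₋₁⁽ˡ⁾ • Uₙ₋₁⁽ˡ ⁺ ²^⁽ⁿ⁻¹⁾⁾` and `Uₙ⁽²ˡ⁾ = Uₙ₋₁⁽ˡ ⁺ ²^⁽ⁿ⁻¹⁾⁾`, where the indices count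
from the beginning of the block. -/
noncomputable def polarU {Ω G : Type*} [Group G] (X : ℕ → Ω → G) : ℕ → ℕ → Ω → G
  | 0, i => X i
  | n + 1, i =>
    if Odd i then fun ω =>
      polarU X n (upperIndex (n + 1) i) ω * polarU X n (upperIndex (n + 1) i + 2 ^ n) ω
    else polarU X n (upperIndex (n + 1) i + 2 ^ n)

/-- The recursively transformed side information: coset products at odd indices, and the map `φ`,
applied to the variable `Uₙ` at the preceding index, at even indices. -/
noncomputable def polarY {Ω G : Type*} [Group G] (X : ℕ → Ω → G) (Y : ℕ → Ω → FiniteCoset G) :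
    ℕ → ℕ → Ω → FiniteCoset G
  | 0, i => Y i
  | n + 1, i =>
    if Odd i then fun ω =>
      FiniteCoset.minus (polarY X Y n (upperIndex (n + 1) i) ω)
        (polarY X Y n (upperIndex (n + 1) i + 2 ^ n) ω)
    else fun ω =>
      FiniteCoset.plus (polarU X (n + 1) (i - 1) ω)
        (polarY X Y n (upperIndex (n + 1) i) ω)
        (polarY X Y n (upperIndex (n + 1) i + 2 ^ n) ω)

/-- The conditioning data of `Uₙ⁽ⁱ⁾`: the variables `Uₙ⁽ʲ⁾` with `j < i` in the block of `i`, and the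
original side information `Yⱼ` of the whole block. -/
noncomputable def blockData {Ω G : Type*} [Group G] (X : ℕ → Ω → G) (Y : ℕ → Ω → FiniteCoset G)
    (n i : ℕ) (ω : Ω) :
    (Set.Ico (blockIndex n i * 2 ^ n + 1) i → G) ×
      (Set.Icc (blockIndex n i * 2 ^ n + 1) ((blockIndex n i + 1) * 2 ^ n) → FiniteCoset G) :=
  (fun j => polarU X n j ω, fun j => Y j ω)

end PolarErasure

/-!
The proof works with conditional laws given sub-σ-algebras of the sample space. `HasCondLaw m μ W V η`
says that, given `m`, the variable `V` has law `η (W ·)` with an `m`-measurable parameter `W`. For the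
kernel `uniformKernel` that draws a uniform point of a finite coset, both assertions of the theorem
follow from the invariant `hasCondLaw_polar`: given the σ-algebra of `blockData X Y n i`, the variable
`polarU X n i` is uniform on `polarY X Y n i`, and the latter is measurable with respect to that
σ-algebra. Indeed such a statement passes to the smaller σ-algebra of `polarY X Y n i`, and the regular
conditional distributions given either one are then both the uniform law on `polarY X Y n i`.

The invariant is proved by induction on `n`. Two variables that are combined come from disjoint blocks,
so given the data of both half blocks they are independent and uniform on cosets `S` and `T`
(`HasCondLaw.prod`). At an odd index the conditioning data are exactly the data of the two half blocks,
because `(u, v) ↦ (u * v, v)` is invertible (`blockSigma_odd`), and at the next index the product is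
added (`blockSigma_even`). What remains is a statement on uniform points `x ∈ S`, `y ∈ T`: the map
`(x, y) ↦ (x * y, y)` is a bijection onto the pairs `(g, y)` with `g ∈ S * T` and `y ∈ φ (g, S, T)`
(`sum_points_mul`), and all these sections have the same cardinality, because the subgroups are normal
(`ncard_minus_mul_ncard_plus`). Hence `x * y` is uniform on `S * T` (`map_mul_uniform`) and, given
`x * y = g`, the point `y` is uniform on `φ (g, S, T)` (`uniform_prod_disintegrate`).

The coset operations have to be measurable for the σ-algebra generated by the counting maps. By
`measurable_of_uniform` a coset-valued map is measurable as soon as the associated uniform laws depend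
measurably on the parameter, which for products and sections follows from measurability of kernels.
-/

namespace PolarErasure

/-! ### Conditional laws given a σ-algebra -/

/-- Given the σ-algebra `m`, the conditional law of `V` is `η (W ·)`, where `W` is `m`-measurable.
The defining property of the conditional law is tested on events `t` of `m` and measurable sets `B`;
this avoids any regularity assumption on the probability space. -/
structure HasCondLaw {Ω 𝓦 E : Type*} (m : MeasurableSpace Ω) {mΩ : MeasurableSpace Ω}
    [MeasurableSpace 𝓦] [MeasurableSpace E] (μ : Measure Ω) (W : Ω → 𝓦) (V : Ω → E)
    (η : Kernel 𝓦 E) : Prop where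
  le : m ≤ mΩ
  measurable_param : Measurable[m] W
  measurable_source : Measurable V
  measure_inter : ∀ t, MeasurableSet[m] t → ∀ B, MeasurableSet B →
    μ (t ∩ V ⁻¹' B) = ∫⁻ ω in t, η (W ω) B ∂μ

/-- The intersections of an event of `m₁` and an event of `m₂` form a π-system that generates
`m₁ ⊔ m₂`. -/
theorem measure_eq_on_sup {Ω : Type*} {m₁ m₂ mΩ : MeasurableSpace Ω} {μ ν : Measure Ω}
    [IsFiniteMeasure μ] (h₁ : m₁ ≤ mΩ) (h₂ : m₂ ≤ mΩ)
    (h : ∀ s, MeasurableSet[m₁] s → ∀ t, MeasurableSet[m₂] t → μ (s ∩ t) = ν (s ∩ t))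
    {u : Set Ω} (hu : MeasurableSet[m₁ ⊔ m₂] u) : μ u = ν u := by
  refine ext_on_measurableSpace_of_generate_finite mΩ
    {u | ∃ s t, MeasurableSet[m₁] s ∧ MeasurableSet[m₂] t ∧ u = s ∩ t} ?_
    (sup_le h₁ h₂) ?_ ?_ ?_ hu
  · rintro _ ⟨s, t, hs, ht, rfl⟩
    exact h s hs t ht
  · apply le_antisymm
    · refine sup_le (fun s hs => ?_) (fun t ht => ?_)
      · exact MeasurableSpace.measurableSet_generateFrom
          ⟨s, Set.univ, hs, @MeasurableSet.univ _ m₂, by simp⟩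
      · exact MeasurableSpace.measurableSet_generateFrom
          ⟨Set.univ, t, @MeasurableSet.univ _ m₁, ht, by simp⟩
    · refine MeasurableSpace.generateFrom_le ?_
      rintro _ ⟨s, t, hs, ht, rfl⟩
      exact @MeasurableSet.inter _ (m₁ ⊔ m₂) _ _ (le_sup_left (a := m₁) (b := m₂) s hs)
        (le_sup_right (a := m₁) (b := m₂) t ht)
  · rintro _ ⟨s, t, hs, ht, rfl⟩ _ ⟨s', t', hs', ht', rfl⟩ -
    exact ⟨s ∩ s', t ∩ t', @MeasurableSet.inter _ m₁ _ _ hs hs',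
      @MeasurableSet.inter _ m₂ _ _ ht ht', Set.inter_inter_inter_comm _ _ _ _⟩
  · simpa using h _ (@MeasurableSet.univ _ m₁) _ (@MeasurableSet.univ _ m₂)

namespace HasCondLaw

variable {Ω 𝓦 E : Type*} {m m' n n' : MeasurableSpace Ω} {mΩ : MeasurableSpace Ω}
  [MeasurableSpace 𝓦] [MeasurableSpace E] {μ : Measure Ω} {W : Ω → 𝓦} {V : Ω → E} {η : Kernel 𝓦 E}

theorem measurable_left (h : HasCondLaw m μ W V η) : Measurable W :=
  h.measurable_param.mono h.le le_rfl

theorem mono (h : HasCondLaw m μ W V η) (hm : m' ≤ m)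
    (hW : Measurable[m'] W) : HasCondLaw m' μ W V η :=
  ⟨hm.trans h.le, hW, h.measurable_source, fun t ht => h.measure_inter t (hm t ht)⟩

theorem map (h : HasCondLaw m μ W V η) {E' : Type*} [MeasurableSpace E'] {f : E → E'}
    (hf : Measurable f) : HasCondLaw m μ W (fun ω => f (V ω)) (η.map f) where
  le := h.le
  measurable_param := h.measurable_param
  measurable_source := hf.comp h.measurable_source
  measure_inter t ht B hB := by
    simp only [Kernel.map_apply' η hf _ hB]
    exact h.measure_inter t ht _ (hf hB)

theorem reparam (h : HasCondLaw m μ W V η) {𝓦' : Type*} [MeasurableSpace 𝓦'] {f : 𝓦 → 𝓦'}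
    (hf : Measurable f) {η' : Kernel 𝓦' E} (hη : ∀ w, η w = η' (f w)) :
    HasCondLaw m μ (fun ω => f (W ω)) V η' where
  le := h.le
  measurable_param := hf.comp h.measurable_param
  measurable_source := h.measurable_source
  measure_inter t ht B hB := by simp only [← hη]; exact h.measure_inter t ht B hB

/-- The joint form of a conditional law: on every event of `m`, the pair `(W, V)` is distributed
according to the law of `W` followed by the kernel `η`. -/
theorem map_restrict [IsFiniteMeasure μ] [IsMarkovKernel η] (h : HasCondLaw m μ W V η)
    {t : Set Ω} (ht : MeasurableSet[m] t) :
    (μ.restrict t).map (fun ω => (W ω, V ω)) = ((μ.restrict t).map W) ⊗ₘ η := by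
  have hW := h.measurable_left
  have hV := h.measurable_source
  refine Measure.ext_prod fun {A B} hA hB => ?_
  rw [Measure.map_apply (hW.prodMk hV) (hA.prod hB), Measure.compProd_apply_prod hA hB,
    Measure.restrict_apply ((hW.prodMk hV) (hA.prod hB)),
    setLIntegral_map hA (η.measurable_coe hB) hW, Measure.restrict_restrict (hW hA),
    ← h.measure_inter _ (@MeasurableSet.inter _ m _ _ (h.measurable_param hA) ht) B hB]
  congr 1
  ext ω
  simp only [Set.mem_inter_iff, Set.mem_preimage, Set.mem_prod]
  tauto

theorem lintegral_eq [IsFiniteMeasure μ] [IsMarkovKernel η] (h : HasCondLaw m μ W V η)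
    {t : Set Ω} (ht : MeasurableSet[m] t) {F : 𝓦 × E → ℝ≥0∞} (hF : Measurable F) :
    ∫⁻ ω in t, F (W ω, V ω) ∂μ = ∫⁻ ω in t, ∫⁻ x, F (W ω, x) ∂(η (W ω)) ∂μ := by
  have hW := h.measurable_left
  rw [← lintegral_map (g := fun ω => (W ω, V ω)) hF (hW.prodMk h.measurable_source), h.map_restrict ht,
    Measure.lintegral_compProd hF, lintegral_map hF.lintegral_kernel_prod_right' hW]

/-- Conditional laws given independent σ-algebras combine to a product law. -/
theorem prod [IsFiniteMeasure μ] {𝓦' E' : Type*} [MeasurableSpace 𝓦'] [MeasurableSpace E']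
    {W' : Ω → 𝓦'} {V' : Ω → E'} {η' : Kernel 𝓦' E'}
    [IsMarkovKernel η] [IsMarkovKernel η']
    (h : HasCondLaw m μ W V η) (h' : HasCondLaw m' μ W' V' η')
    (hn : m ≤ n) (hn' : m' ≤ n')
    (hV : Measurable[n] V) (hV' : Measurable[n'] V') (hind : Indep n n' μ) :
    HasCondLaw (m ⊔ m') μ (fun ω => (W ω, W' ω)) (fun ω => (V ω, V' ω)) (η ∥ₖ η') where
  le := sup_le h.le h'.le
  measurable_param := (h.measurable_param.mono le_sup_left le_rfl).prodMk
    (h'.measurable_param.mono le_sup_right le_rfl)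
  measurable_source := h.measurable_source.prodMk h'.measurable_source
  measure_inter t ht B hB := by
    have hWW := h.measurable_left.prodMk h'.measurable_left
    have hVV := h.measurable_source.prodMk h'.measurable_source
    have ht' : MeasurableSet t := sup_le h.le h'.le t ht
    have hbind : AEMeasurable (fun ω => (η ∥ₖ η') (W ω, W' ω)) (μ.restrict t) :=
      ((η ∥ₖ η').measurable.comp hWW).aemeasurable
    -- Comparing the two measures on the product `E × E'` reduces the claim to rectangles.
    suffices key : (μ.restrict t).map (fun ω => (V ω, V' ω)) =
        (μ.restrict t).bind (fun ω => (η ∥ₖ η') (W ω, W' ω)) by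
      have := congrArg (fun ν => ν B) key
      rw [Measure.map_apply hVV hB, Measure.restrict_apply (hVV hB), Measure.bind_apply hB
        hbind] at this
      rw [Set.inter_comm, this]
    refine Measure.ext_prod fun {B B'} hB hB' => ?_
    rw [Measure.map_apply hVV (hB.prod hB'), Measure.restrict_apply (hVV (hB.prod hB')),
      Measure.bind_apply (hB.prod hB') hbind]
    simp only [Kernel.parallelComp_apply_prod]
    suffices key : μ.restrict ((fun ω => (V ω, V' ω)) ⁻¹' B ×ˢ B') t =
        μ.withDensity (fun ω => η (W ω) B * η' (W' ω) B') t by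
      rwa [Measure.restrict_apply ht', withDensity_apply _ ht', Set.inter_comm] at key
    refine measure_eq_on_sup h.le h'.le (fun s hs s' hs' => ?_) ht
    have hsΩ := h.le s hs
    have hsΩ' := h'.le s' hs'
    have hind' := (Indep_iff n n' μ).1 hind (s ∩ V ⁻¹' B) (s' ∩ V' ⁻¹' B')
      (@MeasurableSet.inter _ n _ _ (hn s hs) (hV hB))
      (@MeasurableSet.inter _ n' _ _ (hn' s' hs') (hV' hB'))
    have e : s ∩ s' ∩ (fun ω => (V ω, V' ω)) ⁻¹' B ×ˢ B' = s ∩ V ⁻¹' B ∩ (s' ∩ V' ⁻¹' B') := by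
      ext ω; simp only [Set.mem_inter_iff, Set.mem_preimage, Set.mem_prod]; tauto
    rw [Measure.restrict_apply (hsΩ.inter hsΩ'), withDensity_apply _ (hsΩ.inter hsΩ'), e, hind',
      h.measure_inter s hs B hB, h'.measure_inter s' hs' B' hB', ← lintegral_indicator hsΩ,
      ← lintegral_indicator hsΩ', ← lintegral_indicator (hsΩ.inter hsΩ')]
    simp only [Set.inter_indicator_mul]
    refine (lintegral_mul_eq_lintegral_mul_lintegral_of_independent_measurableSpace
      (f := s.indicator fun ω => η (W ω) B) (g := s'.indicator fun ω => η' (W' ω) B')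
      h.le h'.le (indep_of_indep_of_le_left (indep_of_indep_of_le_right hind hn') hn) ?_ ?_).symm
    · exact ((η.measurable_coe hB).comp h.measurable_param).indicator hs
    · exact ((η'.measurable_coe hB').comp h'.measurable_param).indicator hs'

/-- Disintegration of a conditional law along `h`: once the value of `h (V)` is added to the
conditioning σ-algebra, the conditional law of `p (V)` is given by the kernel `ζ` that disintegrates
the law of `(h, p)` under `η`. -/
theorem disintegrate [IsFiniteMeasure μ] {E₁ E₂ : Type*} [MeasurableSpace E₁] [MeasurableSpace E₂]
    [IsMarkovKernel η] (hη : HasCondLaw m μ W V η) {h : E → E₁} {p : E → E₂}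
    (hh : Measurable h) (hp : Measurable p) {ζ : Kernel (𝓦 × E₁) E₂} [IsMarkovKernel ζ]
    (hζ : ∀ w, ∀ C, MeasurableSet C → ∀ B, MeasurableSet B →
      η w (h ⁻¹' C ∩ p ⁻¹' B) = ∫⁻ v in h ⁻¹' C, ζ (w, h v) B ∂(η w)) :
    HasCondLaw (m ⊔ MeasurableSpace.comap (fun ω => h (V ω)) inferInstance) μ
      (fun ω => (W ω, h (V ω))) (fun ω => p (V ω)) ζ where
  le := sup_le hη.le (hh.comp hη.measurable_source).comap_le
  measurable_param := (hη.measurable_param.mono le_sup_left le_rfl).prodMk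
    ((comap_measurable _).mono le_sup_right le_rfl)
  measurable_source := hp.comp hη.measurable_source
  measure_inter t ht B hB := by
    have hV := hη.measurable_source
    have hhV : Measurable fun ω => h (V ω) := hh.comp hV
    have hle := sup_le hη.le hhV.comap_le
    suffices key : μ.restrict ((fun ω => p (V ω)) ⁻¹' B) t =
        μ.withDensity (fun ω => ζ (W ω, h (V ω)) B) t by
      rwa [Measure.restrict_apply (hle t ht), withDensity_apply _ (hle t ht)] at key
    refine measure_eq_on_sup hη.le hhV.comap_le (fun s hs r hr => ?_) ht
    obtain ⟨C, hC, rfl⟩ := hr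
    have hs' := hη.le s hs
    rw [Measure.restrict_apply (hs'.inter (hhV hC)), withDensity_apply _ (hs'.inter (hhV hC))]
    have e : s ∩ (fun ω => h (V ω)) ⁻¹' C ∩ (fun ω => p (V ω)) ⁻¹' B =
        s ∩ V ⁻¹' (h ⁻¹' C ∩ p ⁻¹' B) := by
      ext ω; simp only [Set.mem_inter_iff, Set.mem_preimage]; tauto
    rw [e, hη.measure_inter s hs _ ((hh hC).inter (hp hB)), Set.inter_comm s,
      ← Measure.restrict_restrict (hhV hC), ← lintegral_indicator (hhV hC)]
    have hG : Measurable fun x : 𝓦 × E => (h ⁻¹' C).indicator (fun v => ζ (x.1, h v) B) x.2 := by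
      have : (fun x : 𝓦 × E => (h ⁻¹' C).indicator (fun v => ζ (x.1, h v) B) x.2) =
          ((fun x : 𝓦 × E => x.2) ⁻¹' (h ⁻¹' C)).indicator (fun x => ζ (x.1, h x.2) B) := by
        ext x; simp only [Set.indicator]; rfl
      rw [this]
      exact ((ζ.measurable_coe hB).comp
        (measurable_fst.prodMk (hh.comp measurable_snd))).indicator (measurable_snd (hh hC))
    have := hη.lintegral_eq hs hG
    simp only [lintegral_indicator (hh hC), ← hζ _ C hC B hB] at this
    rw [← this]
    rfl

/-- A conditional law is the regular conditional distribution given any variable `Z` that generates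
at most the conditioning σ-algebra and determines the parameter. -/
theorem condDistrib_ae_eq [IsFiniteMeasure μ] [StandardBorelSpace E] [Nonempty E]
    {𝓩 : Type*} [MeasurableSpace 𝓩] {Z : Ω → 𝓩} [IsMarkovKernel η]
    (h : HasCondLaw (MeasurableSpace.comap Z inferInstance) μ W V η) {B : Set E}
    (hB : MeasurableSet B) : ∀ᵐ ω ∂μ, condDistrib V Z μ (Z ω) B = η (W ω) B := by
  have hZ : Measurable Z := fun s hs => h.le _ ⟨s, hs, rfl⟩
  refine ae_of_ae_trim h.le ?_
  have m1 : Measurable[MeasurableSpace.comap Z inferInstance]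
      fun ω => condDistrib V Z μ (Z ω) B := measurable_condDistrib hB
  have m2 : Measurable[MeasurableSpace.comap Z inferInstance] fun ω => η (W ω) B :=
    (η.measurable_coe hB).comp h.measurable_param
  refine ae_eq_of_forall_setLIntegral_eq_of_sigmaFinite m1 m2 fun t ht _ => ?_
  rw [setLIntegral_trim h.le m1 ht, setLIntegral_trim h.le m2 ht, ← h.measure_inter t ht B hB,
    setLIntegral_condDistrib_of_measurableSet hZ h.measurable_source.aemeasurable hB ht]

/-- Conversely, a kernel that agrees with the regular conditional distribution given `Z` is a
conditional law given the σ-algebra of `Z`. -/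
theorem of_condDistrib [IsFiniteMeasure μ] [StandardBorelSpace E] [Nonempty E]
    {𝓩 : Type*} [MeasurableSpace 𝓩] {Z : Ω → 𝓩} {η : Kernel 𝓩 E} (hZ : Measurable Z)
    (hV : Measurable V)
    (h : ∀ B, MeasurableSet B → ∀ᵐ ω ∂μ, condDistrib V Z μ (Z ω) B = η (Z ω) B) :
    HasCondLaw (MeasurableSpace.comap Z inferInstance) μ Z V η where
  le := hZ.comap_le
  measurable_param := comap_measurable _
  measurable_source := hV
  measure_inter t ht B hB := by
    rw [← setLIntegral_condDistrib_of_measurableSet hZ hV.aemeasurable hB ht]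
    exact lintegral_congr_ae (ae_restrict_of_ae (h B hB))

end HasCondLaw

/-! ### Products and sections of finite cosets -/

section Cosets

variable {G : Type*} [Group G]

theorem FiniteCoset.finite (S : FiniteCoset G) : S.carrier.Finite := by
  obtain ⟨a, H, -, hf, h⟩ := S.isFiniteCoset
  rw [h]; exact hf.smul_set

theorem FiniteCoset.nonempty (S : FiniteCoset G) : S.carrier.Nonempty := by
  obtain ⟨a, H, -, -, h⟩ := S.isFiniteCoset
  rw [h]; exact ⟨a • 1, 1, H.one_mem, rfl⟩

theorem FiniteCoset.ncard_ne_zero (S : FiniteCoset G) : (S.carrier.ncard : ℝ≥0∞) ≠ 0 := by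
  simp [Set.ncard_eq_zero S.finite, S.nonempty.ne_empty]

/-- The points of a finite coset as a `Finset`. -/
noncomputable def FiniteCoset.points (S : FiniteCoset G) : Finset G := S.finite.toFinset

@[simp] theorem FiniteCoset.mem_points {S : FiniteCoset G} {x : G} :
    x ∈ S.points ↔ x ∈ S.carrier := S.finite.mem_toFinset

theorem FiniteCoset.card_points (S : FiniteCoset G) : S.points.card = S.carrier.ncard :=
  (Set.ncard_eq_toFinset_card _ S.finite).symm

theorem mem_phi {g y : G} {S T : FiniteCoset G} :
    y ∈ phi g S T ↔ g * y⁻¹ ∈ S.carrier ∧ y ∈ T.carrier := by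
  unfold phi
  rw [Set.mem_inter_iff, Set.mul_singleton, Set.mem_image]
  refine and_congr_left fun _ => ⟨?_, fun h => ⟨y * g⁻¹, by simpa using h, by simp⟩⟩
  rintro ⟨z, hz, rfl⟩
  simpa using hz

theorem phi_nonempty_iff {g : G} {S T : FiniteCoset G} :
    (phi g S T).Nonempty ↔ g ∈ (S.minus T).carrier := by
  constructor
  · rintro ⟨y, hy⟩
    rw [mem_phi] at hy
    exact ⟨_, hy.1, y, hy.2, by simp⟩
  · rintro ⟨x, hx, y, hy, rfl⟩
    exact ⟨y, mem_phi.2 ⟨by simpa using hx, hy⟩⟩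

theorem FiniteCoset.plus_carrier {g : G} {S T : FiniteCoset G}
    (hg : g ∈ (S.minus T).carrier) : (FiniteCoset.plus g S T).carrier = phi g S T := by
  unfold FiniteCoset.plus
  rw [dif_pos (phi_nonempty_iff.2 hg)]

theorem FiniteCoset.plus_of_notMem {g : G} {S T : FiniteCoset G}
    (hg : g ∉ (S.minus T).carrier) : FiniteCoset.plus g S T = ⟨{1}, isFiniteCoset_one⟩ := by
  unfold FiniteCoset.plus
  rw [dif_neg (mt phi_nonempty_iff.1 hg)]

/-- The map `(x, y) ↦ (x * y, y)` is a bijection from `S × T` onto the pairs `(g, y)` with `g ∈ S * T`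
and `y ∈ φ (g, S, T)`. -/
theorem sum_points_mul {M : Type*} [AddCommMonoid M] (S T : FiniteCoset G) (F : G → G → M) :
    ∑ x ∈ S.points, ∑ y ∈ T.points, F (x * y) y =
      ∑ g ∈ (S.minus T).points, ∑ y ∈ (FiniteCoset.plus g S T).points, F g y := by
  rw [Finset.sum_sigma', Finset.sum_sigma']
  refine Finset.sum_bij' (fun p _ => ⟨p.1 * p.2, p.2⟩) (fun q _ => ⟨q.1 * q.2⁻¹, q.2⟩) ?_ ?_ ?_ ?_ ?_
  · rintro ⟨x, y⟩ h
    simp only [Finset.mem_sigma, FiniteCoset.mem_points] at h ⊢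
    have hm : x * y ∈ (S.minus T).carrier := Set.mul_mem_mul h.1 h.2
    rw [FiniteCoset.plus_carrier hm, mem_phi]
    exact ⟨hm, by simpa using h.1, h.2⟩
  · rintro ⟨g, y⟩ h
    simp only [Finset.mem_sigma, FiniteCoset.mem_points] at h ⊢
    rw [FiniteCoset.plus_carrier h.1, mem_phi] at h
    exact h.2
  · rintro ⟨x, y⟩ -
    simp
  · rintro ⟨g, y⟩ -
    simp
  · rintro ⟨x, y⟩ -
    rfl

/-- All nonempty sections `φ (g, S, T)` have the same cardinality, that of the intersection of the
two underlying subgroups; hence it is `|S| * |T| / |S * T|`. -/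
theorem ncard_minus_mul_ncard_plus {g : G} {S T : FiniteCoset G}
    (hg : g ∈ (S.minus T).carrier) :
    (S.minus T).carrier.ncard * (FiniteCoset.plus g S T).carrier.ncard =
      S.carrier.ncard * T.carrier.ncard := by
  obtain ⟨a, H, hH, -, hS⟩ := S.isFiniteCoset
  obtain ⟨b, K, hK, -, hT⟩ := T.isFiniteCoset
  have key : ∀ g ∈ (S.minus T).carrier,
      (FiniteCoset.plus g S T).carrier.ncard = ((H ⊓ K : Subgroup G) : Set G).ncard := by
    intro g hg
    rw [FiniteCoset.plus_carrier hg]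
    obtain ⟨x, hx⟩ := phi_nonempty_iff.2 hg
    rw [phi_coset g a b H K hH S T hS hT] at hx ⊢
    obtain ⟨hx1, hx2⟩ := hx
    rw [mem_coset_iff] at hx1 hx2
    rw [← Set.ncard_smul_set x ((H ⊓ K : Subgroup G) : Set G)]
    congr 1
    ext y
    simp only [Set.mem_inter_iff, mem_coset_iff, Subgroup.mem_inf]
    have e1 : (a⁻¹ * g)⁻¹ * y = ((a⁻¹ * g)⁻¹ * x) * (x⁻¹ * y) := by group
    have e2 : b⁻¹ * y = (b⁻¹ * x) * (x⁻¹ * y) := by group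
    rw [e1, e2, H.mul_mem_cancel_left hx1, K.mul_mem_cancel_left hx2]
  have h := sum_points_mul S T (fun _ _ => 1)
  simp only [Finset.sum_const, smul_eq_mul, mul_one, FiniteCoset.card_points] at h
  rw [h, key g hg, Finset.sum_congr rfl fun g hg => key g (FiniteCoset.mem_points.1 hg),
    Finset.sum_const, FiniteCoset.card_points, smul_eq_mul]

end Cosets

/-! ### The uniform distribution on a finite coset -/

section Uniform

variable {G : Type*} [Group G] [MeasurableSpace G]

/-- The uniform distribution on a finite coset. -/
noncomputable def FiniteCoset.uniform (S : FiniteCoset G) : Measure G :=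
  (S.carrier.ncard : ℝ≥0∞)⁻¹ • ∑ x ∈ S.points, Measure.dirac x

theorem FiniteCoset.lintegral_uniform (S : FiniteCoset G) {F : G → ℝ≥0∞} (hF : Measurable F) :
    ∫⁻ x, F x ∂S.uniform = (S.carrier.ncard : ℝ≥0∞)⁻¹ * ∑ x ∈ S.points, F x := by
  rw [FiniteCoset.uniform, lintegral_smul_measure, lintegral_finsetSum_measure, smul_eq_mul]
  simp only [lintegral_dirac' _ hF]

theorem FiniteCoset.uniform_apply_sum (S : FiniteCoset G) {B : Set G} (hB : MeasurableSet B) :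
    S.uniform B = (S.carrier.ncard : ℝ≥0∞)⁻¹ * ∑ x ∈ S.points, B.indicator 1 x := by
  rw [← lintegral_indicator_one hB, S.lintegral_uniform (measurable_one.indicator hB)]

theorem FiniteCoset.uniform_apply (S : FiniteCoset G) {B : Set G} (hB : MeasurableSet B) :
    S.uniform B = ((B ∩ S.carrier).ncard : ℝ≥0∞) / (S.carrier.ncard : ℝ≥0∞) := by
  classical
  rw [S.uniform_apply_sum hB, mul_comm, ← div_eq_mul_inv]
  congr 1
  have : (B ∩ S.carrier) = ((S.points.filter (· ∈ B) : Finset G) : Set G) := by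
    ext x; simp [and_comm]
  rw [this, Set.ncard_coe_finset, Finset.card_filter]
  simp [Set.indicator]

instance (S : FiniteCoset G) : IsProbabilityMeasure S.uniform :=
  ⟨by rw [S.uniform_apply MeasurableSet.univ, Set.univ_inter,
    ENNReal.div_self S.ncard_ne_zero (ENNReal.natCast_ne_top _)]⟩

theorem FiniteCoset.measurable_ncard_inter {B : Set G} (hB : MeasurableSet B) :
    Measurable fun S : FiniteCoset G => (B ∩ S.carrier).ncard :=
  Measurable.of_comap_le (le_iSup (fun B : {B : Set G // MeasurableSet B} =>
    MeasurableSpace.comap (fun S : FiniteCoset G => (B.1 ∩ S.carrier).ncard) ⊤) ⟨B, hB⟩)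

/-- The Markov kernel that draws a uniformly distributed point of a finite coset. -/
noncomputable def uniformKernel (G : Type*) [Group G] [MeasurableSpace G] :
    Kernel (FiniteCoset G) G where
  toFun := FiniteCoset.uniform
  measurable' := by
    refine Measure.measurable_of_measurable_coe _ fun B hB => ?_
    simp only [FiniteCoset.uniform_apply _ hB]
    have h := FiniteCoset.measurable_ncard_inter (G := G) MeasurableSet.univ
    simp only [Set.univ_inter] at h
    exact (measurable_from_nat.comp (FiniteCoset.measurable_ncard_inter hB)).div
      (measurable_from_nat.comp h)

@[simp] theorem uniformKernel_apply (S : FiniteCoset G) : uniformKernel G S = S.uniform := rfl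

instance : IsMarkovKernel (uniformKernel G) :=
  ⟨fun S => by rw [uniformKernel_apply]; infer_instance⟩

end Uniform

/-! ### Products of independent uniform points -/

section ProductLaw

variable {G : Type*} [Group G] [MeasurableSpace G] [MeasurableMul₂ G]

theorem lintegral_uniform_prod_uniform (S T : FiniteCoset G) {F : G × G → ℝ≥0∞}
    (hF : Measurable F) :
    ∫⁻ v, F (v.1 * v.2, v.2) ∂(S.uniform.prod T.uniform) =
      (S.carrier.ncard : ℝ≥0∞)⁻¹ * (T.carrier.ncard : ℝ≥0∞)⁻¹ *
        ∑ g ∈ (S.minus T).points, ∑ y ∈ (FiniteCoset.plus g S T).points, F (g, y) := by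
  have hF' : Measurable fun v : G × G => F (v.1 * v.2, v.2) :=
    hF.comp ((measurable_fst.mul measurable_snd).prodMk measurable_snd)
  rw [← sum_points_mul S T fun g y => F (g, y), lintegral_prod _ hF'.aemeasurable,
    S.lintegral_uniform hF'.lintegral_prod_right', mul_assoc,
    Finset.mul_sum S.points _ (T.carrier.ncard : ℝ≥0∞)⁻¹]
  congr 1
  refine Finset.sum_congr rfl fun x _ => ?_
  exact T.lintegral_uniform (hF'.comp measurable_prodMk_left)

theorem uniform_prod_uniform_apply (S T : FiniteCoset G) {A : Set (G × G)}
    (hA : MeasurableSet A) :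
    (S.uniform.prod T.uniform) ((fun v => (v.1 * v.2, v.2)) ⁻¹' A) =
      (S.carrier.ncard : ℝ≥0∞)⁻¹ * (T.carrier.ncard : ℝ≥0∞)⁻¹ *
        ∑ g ∈ (S.minus T).points, ∑ y ∈ (FiniteCoset.plus g S T).points, A.indicator 1 (g, y) := by
  have hm : Measurable fun v : G × G => (v.1 * v.2, v.2) :=
    (measurable_fst.mul measurable_snd).prodMk measurable_snd
  rw [← lintegral_uniform_prod_uniform S T (measurable_one.indicator hA),
    ← lintegral_indicator_one (hm hA)]
  rfl

/-- The product of independent uniform points of `S` and `T` is uniform on `S * T`. -/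
theorem map_mul_uniform (S T : FiniteCoset G) :
    (S.uniform.prod T.uniform).map (fun v => v.1 * v.2) = (S.minus T).uniform := by
  have hm : Measurable fun v : G × G => v.1 * v.2 := measurable_fst.mul measurable_snd
  ext B hB
  have h := uniform_prod_uniform_apply S T (measurable_fst hB)
  rw [Measure.map_apply hm hB]
  refine h.trans ?_
  rw [FiniteCoset.uniform_apply_sum _ hB, Finset.mul_sum, Finset.mul_sum]
  refine Finset.sum_congr rfl fun g hg => ?_
  have hc := ncard_minus_mul_ncard_plus (FiniteCoset.mem_points.1 hg)
  have hc' := congrArg (Nat.cast (R := ℝ≥0∞)) hc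
  push_cast at hc'
  have e : ∀ y ∈ (FiniteCoset.plus g S T).points,
      (Prod.fst ⁻¹' B : Set (G × G)).indicator (1 : G × G → ℝ≥0∞) (g, y) = B.indicator 1 g := by
    intro y _; by_cases hg : g ∈ B <;> simp [hg]
  rw [Finset.sum_congr rfl e, Finset.sum_const, FiniteCoset.card_points, nsmul_eq_mul, ← mul_assoc]
  congr 1
  rw [← ENNReal.mul_inv (Or.inl S.ncard_ne_zero) (Or.inl (ENNReal.natCast_ne_top _)), ← hc',
    ENNReal.mul_inv (Or.inl (FiniteCoset.ncard_ne_zero _)) (Or.inl (ENNReal.natCast_ne_top _)),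
    mul_assoc, ENNReal.inv_mul_cancel (FiniteCoset.ncard_ne_zero _) (ENNReal.natCast_ne_top _),
    mul_one]

/-- For independent uniform points `x` of `S` and `y` of `T`, the conditional law of `y` given the
product `x * y` is uniform on `φ (x * y, S, T)`. -/
theorem uniform_prod_disintegrate (S T : FiniteCoset G) {C B : Set G} (hC : MeasurableSet C)
    (hB : MeasurableSet B)
    (hplus : Measurable fun g => FiniteCoset.plus g S T) :
    (S.uniform.prod T.uniform) ((fun v => v.1 * v.2) ⁻¹' C ∩ Prod.snd ⁻¹' B) =
      ∫⁻ v in (fun v => v.1 * v.2) ⁻¹' C, (FiniteCoset.plus (v.1 * v.2) S T).uniform B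
        ∂(S.uniform.prod T.uniform) := by
  have hm : Measurable fun v : G × G => v.1 * v.2 := measurable_fst.mul measurable_snd
  have h1 := uniform_prod_uniform_apply S T (hC.prod hB)
  have hF : Measurable fun x : G × G =>
      C.indicator (fun g => (FiniteCoset.plus g S T).uniform B) x.1 :=
    ((((uniformKernel G).measurable_coe hB).comp hplus).indicator hC).comp measurable_fst
  have h2 := lintegral_uniform_prod_uniform S T hF
  rw [← lintegral_indicator (hm hC)]
  refine (h1.trans ?_).trans h2.symm
  congr 1
  refine Finset.sum_congr rfl fun g _ => ?_
  dsimp only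
  rw [Finset.sum_const, FiniteCoset.card_points, nsmul_eq_mul]
  by_cases hg : g ∈ C
  · rw [Set.indicator_of_mem hg, FiniteCoset.uniform_apply_sum _ hB, ← mul_assoc,
      ENNReal.mul_inv_cancel (FiniteCoset.ncard_ne_zero _) (ENNReal.natCast_ne_top _), one_mul]
    refine Finset.sum_congr rfl fun y _ => ?_
    by_cases hy : y ∈ B <;> simp [hg, hy]
  · rw [Set.indicator_of_notMem hg, mul_zero]
    exact Finset.sum_eq_zero fun y _ => by simp [hg]

end ProductLaw

/-! ### Measurability of the operations on cosets -/

section Measurability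

variable {G : Type*} [Group G] [MeasurableSpace G] [StandardBorelSpace G]

/-- The σ-algebra on the finite cosets is generated by the maps `S ↦ S.uniform B`: the cardinality of
`S` can be recovered from the collision probability `1 / |S|` of two independent uniform points. -/
theorem measurable_of_uniform {α : Type*} [MeasurableSpace α] {f : α → FiniteCoset G}
    (hf : ∀ B, MeasurableSet B → Measurable fun a => (f a).uniform B) : Measurable f := by
  let k : Kernel α G := ⟨fun a => (f a).uniform, Measure.measurable_of_measurable_coe _ hf⟩
  have hk : IsMarkovKernel k := ⟨fun a => inferInstanceAs (IsProbabilityMeasure (f a).uniform)⟩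
  have hcoll : ∀ a, (k ×ₖ k) a (Set.diagonal G) = ((f a).carrier.ncard : ℝ≥0∞)⁻¹ := by
    intro a
    have hd : ∀ x : G, Prod.mk x ⁻¹' Set.diagonal G = {x} := by intro x; ext y; simp [eq_comm]
    rw [Kernel.prod_apply, Measure.prod_apply measurableSet_diagonal]
    simp only [hd]
    change ∫⁻ x, (f a).uniform {x} ∂(f a).uniform = _
    have hm : Measurable fun x => (f a).uniform {x} := by
      have := measurable_measure_prodMk_left (ν := (f a).uniform)
        (measurableSet_diagonal (α := G))
      simpa only [hd] using this
    rw [FiniteCoset.lintegral_uniform _ hm]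
    have : ∀ x ∈ (f a).points, (f a).uniform {x} = ((f a).carrier.ncard : ℝ≥0∞)⁻¹ := by
      intro x hx
      rw [FiniteCoset.uniform_apply _ (measurableSet_singleton x),
        Set.singleton_inter_of_mem (FiniteCoset.mem_points.1 hx)]
      simp
    rw [Finset.sum_congr rfl this, Finset.sum_const, FiniteCoset.card_points, nsmul_eq_mul,
      ENNReal.mul_inv_cancel (f a).ncard_ne_zero (ENNReal.natCast_ne_top _), mul_one]
  have hcard : Measurable fun a => ((f a).carrier.ncard : ℝ≥0∞)⁻¹ := by
    simp only [← hcoll]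
    exact (k ×ₖ k).measurable_coe measurableSet_diagonal
  rw [measurable_iff_comap_le]
  unfold FiniteCoset.instMeasurableSpace
  rw [MeasurableSpace.comap_iSup]
  refine iSup_le fun B => ?_
  rw [MeasurableSpace.comap_comp, ← measurable_iff_comap_le]
  have hcast : Measurable fun a => ((B.1 ∩ (f a).carrier).ncard : ℝ≥0∞) := by
    have : ∀ a, ((B.1 ∩ (f a).carrier).ncard : ℝ≥0∞) =
        (f a).uniform B.1 * (((f a).carrier.ncard : ℝ≥0∞)⁻¹)⁻¹ := by
      intro a
      rw [FiniteCoset.uniform_apply _ B.2, inv_inv,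
        ENNReal.div_mul_cancel (f a).ncard_ne_zero (ENNReal.natCast_ne_top _)]
    simp only [this]
    exact (hf B.1 B.2).mul hcard.inv
  refine measurable_to_countable' fun n => ?_
  have : ((fun S : FiniteCoset G => (B.1 ∩ S.carrier).ncard) ∘ f) ⁻¹' {n} =
      (fun a => ((B.1 ∩ (f a).carrier).ncard : ℝ≥0∞)) ⁻¹' {(n : ℝ≥0∞)} := by
    ext a; simp
  rw [this]
  exact hcast (measurableSet_singleton _)

variable [MeasurableMul₂ G]

theorem measurable_minus :
    Measurable fun p : FiniteCoset G × FiniteCoset G => FiniteCoset.minus p.1 p.2 := by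
  refine measurable_of_uniform fun B hB => ?_
  have hm : Measurable fun v : G × G => v.1 * v.2 := measurable_fst.mul measurable_snd
  have := ((uniformKernel G) ∥ₖ (uniformKernel G)).measurable_coe (hm hB)
  simp only [Kernel.parallelComp_apply, uniformKernel_apply] at this
  simpa only [← map_mul_uniform, Measure.map_apply hm hB] using this

/-- Bayes' formula: the uniform distribution on `φ (g, S, T)` is a ratio of the probabilities that
independent uniform points `x` of `S` and `y` of `T` satisfy `x * y = g`, `y ∈ B`, respectively
`x * y = g`. The denominator vanishes exactly when `φ (g, S, T)` is empty. -/
theorem measurable_plus :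
    Measurable fun p : (FiniteCoset G × FiniteCoset G) × G =>
      FiniteCoset.plus p.2 p.1.1 p.1.2 := by
  classical
  refine measurable_of_uniform fun B hB => ?_
  have hA : ∀ (g : G) {B : Set G}, MeasurableSet B → MeasurableSet ({g} ×ˢ B) :=
    fun g B hB => (measurableSet_singleton g).prod hB
  let N : Set G → (FiniteCoset G × FiniteCoset G) × G → ℝ≥0∞ := fun B p =>
    (p.1.1.uniform.prod p.1.2.uniform) ((fun v => (v.1 * v.2, v.2)) ⁻¹' ({p.2} ×ˢ B))
  have hN : ∀ B, MeasurableSet B → Measurable (N B) := by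
    intro B hB
    let η : Kernel ((FiniteCoset G × FiniteCoset G) × G) (G × G) :=
      ((uniformKernel G) ∥ₖ (uniformKernel G)).comap Prod.fst measurable_fst
    have hset : MeasurableSet {q : ((FiniteCoset G × FiniteCoset G) × G) × (G × G) |
        q.2.1 * q.2.2 = q.1.2 ∧ q.2.2 ∈ B} := by
      refine MeasurableSet.inter (measurableSet_eq_fun ?_ ?_) ?_
      · exact (measurable_fst.comp measurable_snd).mul (measurable_snd.comp measurable_snd)
      · exact measurable_snd.comp measurable_fst
      · exact (measurable_snd.comp measurable_snd) hB
    have := Kernel.measurable_kernel_prodMk_left (κ := η) hset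
    simp only [η, Kernel.comap_apply, Kernel.parallelComp_apply, uniformKernel_apply] at this
    exact this
  have hNval : ∀ B, MeasurableSet B → ∀ p, N B p =
      if p.2 ∈ (p.1.1.minus p.1.2).carrier then
        (p.1.1.carrier.ncard : ℝ≥0∞)⁻¹ * (p.1.2.carrier.ncard : ℝ≥0∞)⁻¹ *
          ∑ y ∈ (FiniteCoset.plus p.2 p.1.1 p.1.2).points, B.indicator 1 y
      else 0 := by
    intro B hB p
    have e : ∀ g ∈ (p.1.1.minus p.1.2).points,
        ∑ y ∈ (FiniteCoset.plus g p.1.1 p.1.2).points,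
          ({p.2} ×ˢ B : Set (G × G)).indicator (1 : G × G → ℝ≥0∞) (g, y) =
        if p.2 = g then ∑ y ∈ (FiniteCoset.plus g p.1.1 p.1.2).points, B.indicator 1 y else 0 := by
      intro g _
      split_ifs with h
      · subst h
        refine Finset.sum_congr rfl fun y _ => ?_
        by_cases hy : y ∈ B <;> simp [hy]
      · exact Finset.sum_eq_zero fun y _ => by simp [Ne.symm h]
    simp only [N]
    rw [uniform_prod_uniform_apply _ _ (hA p.2 hB), Finset.sum_congr rfl e, Finset.sum_ite_eq]
    simp only [FiniteCoset.mem_points, mul_ite, mul_zero]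
  have hc : ∀ p : (FiniteCoset G × FiniteCoset G) × G,
      (p.1.1.carrier.ncard : ℝ≥0∞)⁻¹ * (p.1.2.carrier.ncard : ℝ≥0∞)⁻¹ ≠ 0 ∧
      (p.1.1.carrier.ncard : ℝ≥0∞)⁻¹ * (p.1.2.carrier.ncard : ℝ≥0∞)⁻¹ ≠ ⊤ := fun p =>
    ⟨mul_ne_zero (by simp) (by simp), ENNReal.mul_ne_top
      (ENNReal.inv_ne_top.2 (FiniteCoset.ncard_ne_zero _))
      (ENNReal.inv_ne_top.2 (FiniteCoset.ncard_ne_zero _))⟩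
  have hval : ∀ p : (FiniteCoset G × FiniteCoset G) × G,
      (FiniteCoset.plus p.2 p.1.1 p.1.2).uniform B =
        if N Set.univ p = 0 then
          (⟨{1}, isFiniteCoset_one⟩ : FiniteCoset G).uniform B
        else N B p / N Set.univ p := by
    intro p
    rw [hNval _ MeasurableSet.univ, hNval _ hB]
    by_cases h : p.2 ∈ (p.1.1.minus p.1.2).carrier
    · have hsum : ∑ y ∈ (FiniteCoset.plus p.2 p.1.1 p.1.2).points,
          (Set.univ : Set G).indicator (1 : G → ℝ≥0∞) y =
            ((FiniteCoset.plus p.2 p.1.1 p.1.2).carrier.ncard : ℝ≥0∞) := by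
        simp [FiniteCoset.card_points]
      rw [if_pos h, if_pos h, hsum, if_neg (mul_ne_zero (hc p).1 (FiniteCoset.ncard_ne_zero _)),
        ENNReal.mul_div_mul_left _ _ (hc p).1 (hc p).2, FiniteCoset.uniform_apply_sum _ hB,
        mul_comm, div_eq_mul_inv]
    · rw [if_neg h, if_pos rfl, FiniteCoset.plus_of_notMem h]
  simp only [hval]
  exact Measurable.ite (hN _ MeasurableSet.univ (measurableSet_singleton 0)) measurable_const
    ((hN _ hB).div (hN _ MeasurableSet.univ))

theorem measurable_plus_left (S T : FiniteCoset G) :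
    Measurable fun g => FiniteCoset.plus g S T := by
  have h := (measurable_plus (G := G)).comp (measurable_prodMk_left (x := (S, T)))
  simpa only [Function.comp_def] using h

end Measurability

/-! ### The recursion in terms of blocks -/

theorem blockIndex_eq {n q r : ℕ} (h1 : 1 ≤ r) (h2 : r ≤ 2 ^ n) :
    blockIndex n (q * 2 ^ n + r) = q := by
  unfold blockIndex
  apply Nat.div_eq_of_lt_le
  · omega
  · rw [add_mul]; omega

theorem exists_eq_block (n : ℕ) {i : ℕ} (hi : 1 ≤ i) :
    ∃ q r, 1 ≤ r ∧ r ≤ 2 ^ n ∧ i = q * 2 ^ n + r := by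
  refine ⟨(i - 1) / 2 ^ n, (i - 1) % 2 ^ n + 1, by omega, ?_, ?_⟩
  · exact Nat.mod_lt _ (by positivity)
  · have := Nat.div_add_mod' (i - 1) (2 ^ n)
    omega

theorem exists_odd_or_even {n r : ℕ} (h1 : 1 ≤ r) (h2 : r ≤ 2 ^ (n + 1)) :
    ∃ l, 1 ≤ l ∧ l ≤ 2 ^ n ∧ (r = 2 * l - 1 ∨ r = 2 * l) := by
  rw [pow_succ] at h2
  exact ⟨(r + 1) / 2, by omega, by omega, by omega⟩

theorem left_block_index (n q l : ℕ) : q * 2 ^ (n + 1) + l = 2 * q * 2 ^ n + l := by ring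

theorem right_block_index (n q l : ℕ) :
    q * 2 ^ (n + 1) + l + 2 ^ n = (2 * q + 1) * 2 ^ n + l := by ring

theorem odd_index {n q l : ℕ} (h1 : 1 ≤ l) : Odd (q * 2 ^ (n + 1) + (2 * l - 1)) :=
  ⟨q * 2 ^ n + (l - 1), by rw [pow_succ, ← mul_assoc]; omega⟩

theorem not_odd_index {n q l : ℕ} : ¬ Odd (q * 2 ^ (n + 1) + 2 * l) := by
  rw [Nat.not_odd_iff_even]
  exact ⟨q * 2 ^ n + l, by ring⟩

section Recursion

variable {Ω G : Type*} [Group G] (X : ℕ → Ω → G) (Y : ℕ → Ω → FiniteCoset G) {n q l : ℕ}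

theorem polarU_odd (h1 : 1 ≤ l) (h2 : l ≤ 2 ^ n) :
    polarU X (n + 1) (q * 2 ^ (n + 1) + (2 * l - 1)) =
      fun ω => polarU X n (2 * q * 2 ^ n + l) ω * polarU X n ((2 * q + 1) * 2 ^ n + l) ω := by
  rw [polarU, if_pos (odd_index h1), upperIndex_odd n q l h1 h2, right_block_index,
    left_block_index]

theorem polarU_even (h1 : 1 ≤ l) (h2 : l ≤ 2 ^ n) :
    polarU X (n + 1) (q * 2 ^ (n + 1) + 2 * l) = polarU X n ((2 * q + 1) * 2 ^ n + l) := by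
  rw [polarU, if_neg not_odd_index, upperIndex_even n q l h1 h2, right_block_index]

theorem polarY_odd (h1 : 1 ≤ l) (h2 : l ≤ 2 ^ n) :
    polarY X Y (n + 1) (q * 2 ^ (n + 1) + (2 * l - 1)) =
      fun ω => (polarY X Y n (2 * q * 2 ^ n + l) ω).minus
        (polarY X Y n ((2 * q + 1) * 2 ^ n + l) ω) := by
  rw [polarY, if_pos (odd_index h1), upperIndex_odd n q l h1 h2, right_block_index,
    left_block_index]

theorem polarY_even (h1 : 1 ≤ l) (h2 : l ≤ 2 ^ n) :
    polarY X Y (n + 1) (q * 2 ^ (n + 1) + 2 * l) =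
      fun ω => FiniteCoset.plus
        (polarU X n (2 * q * 2 ^ n + l) ω * polarU X n ((2 * q + 1) * 2 ^ n + l) ω)
        (polarY X Y n (2 * q * 2 ^ n + l) ω) (polarY X Y n ((2 * q + 1) * 2 ^ n + l) ω) := by
  have e : q * 2 ^ (n + 1) + 2 * l - 1 = q * 2 ^ (n + 1) + (2 * l - 1) := by omega
  rw [polarY, if_neg not_odd_index, upperIndex_even n q l h1 h2, e, polarU_odd X h1 h2,
    right_block_index, left_block_index]

variable {X Y}

theorem measurable_polarU [MeasurableSpace G] [MeasurableMul₂ G] [mΩ : MeasurableSpace Ω] :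
    ∀ {n q l : ℕ}, 1 ≤ l → l ≤ 2 ^ n →
      (∀ s, 1 ≤ s → s ≤ 2 ^ n → Measurable (X (q * 2 ^ n + s))) →
      Measurable (polarU X n (q * 2 ^ n + l)) := by
  intro n
  induction n with
  | zero => exact fun {q l} h1 h2 h => h l h1 h2
  | succ n ih =>
    intro q r h1 h2 h
    have hp : 2 ^ (n + 1) = 2 ^ n + 2 ^ n := by ring
    have hleft : ∀ l, 1 ≤ l → l ≤ 2 ^ n → Measurable (polarU X n (2 * q * 2 ^ n + l)) :=
      fun l hl hl' => ih hl hl' fun s hs hs' => by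
        rw [← left_block_index]; exact h s hs (by omega)
    have hright : ∀ l, 1 ≤ l → l ≤ 2 ^ n → Measurable (polarU X n ((2 * q + 1) * 2 ^ n + l)) :=
      fun l hl hl' => ih hl hl' fun s hs hs' => by
        rw [← right_block_index, add_assoc]; exact h (s + 2 ^ n) (by omega) (by omega)
    obtain ⟨l, hl, hl', rfl | rfl⟩ := exists_odd_or_even h1 h2
    · rw [polarU_odd X hl hl']
      exact (hleft l hl hl').mul (hright l hl hl')
    · rw [polarU_even X hl hl']
      exact hright l hl hl'

end Recursion

/-! ### The σ-algebras of the conditioning data -/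

section BlockSigma

variable {Ω G : Type*} [Group G] [MeasurableSpace G] (X : ℕ → Ω → G)
  (Y : ℕ → Ω → FiniteCoset G) {n q l r s : ℕ}

/-- The σ-algebra generated by the conditioning data of the `r`-th variable in the block `q` of
level `n`. -/
noncomputable abbrev blockSigma (n q r : ℕ) : MeasurableSpace Ω :=
  MeasurableSpace.comap (blockData X Y n (q * 2 ^ n + r)) inferInstance

variable {X Y}

theorem measurable_polarU_blockSigma (hs : 1 ≤ s) (hsr : s < r) (hr : r ≤ 2 ^ n) :
    Measurable[blockSigma X Y n q r] (polarU X n (q * 2 ^ n + s)) := by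
  have hq : blockIndex n (q * 2 ^ n + r) = q := blockIndex_eq (by omega) hr
  have h : Measurable[blockSigma X Y n q r] (blockData X Y n (q * 2 ^ n + r)) :=
    comap_measurable _
  exact (measurable_pi_apply (⟨q * 2 ^ n + s, by rw [hq]; constructor <;> omega⟩ :
    Set.Ico (blockIndex n (q * 2 ^ n + r) * 2 ^ n + 1) (q * 2 ^ n + r))).comp
    (measurable_fst.comp h)

theorem measurable_side_blockSigma (hs : 1 ≤ s) (hs' : s ≤ 2 ^ n) (hr : 1 ≤ r) (hr' : r ≤ 2 ^ n) :
    Measurable[blockSigma X Y n q r] (Y (q * 2 ^ n + s)) := by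
  have hq : blockIndex n (q * 2 ^ n + r) = q := blockIndex_eq hr hr'
  have h : Measurable[blockSigma X Y n q r] (blockData X Y n (q * 2 ^ n + r)) :=
    comap_measurable _
  exact (measurable_pi_apply (⟨q * 2 ^ n + s, by rw [hq, add_mul]; constructor <;> omega⟩ :
    Set.Icc (blockIndex n (q * 2 ^ n + r) * 2 ^ n + 1)
      ((blockIndex n (q * 2 ^ n + r) + 1) * 2 ^ n))).comp (measurable_snd.comp h)

theorem blockSigma_le {m : MeasurableSpace Ω} (hr : 1 ≤ r) (hr' : r ≤ 2 ^ n)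
    (hU : ∀ s, 1 ≤ s → s < r → Measurable[m] (polarU X n (q * 2 ^ n + s)))
    (hY : ∀ s, 1 ≤ s → s ≤ 2 ^ n → Measurable[m] (Y (q * 2 ^ n + s))) :
    blockSigma X Y n q r ≤ m := by
  have hq : blockIndex n (q * 2 ^ n + r) = q := blockIndex_eq hr hr'
  refine Measurable.comap_le (Measurable.prodMk ?_ ?_)
  · refine measurable_pi_lambda _ fun j => ?_
    obtain ⟨j, h1, h2⟩ := j
    rw [hq] at h1
    obtain ⟨s, rfl⟩ := Nat.exists_eq_add_of_le (Nat.le_of_succ_le h1)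
    exact hU s (by omega) (by omega)
  · refine measurable_pi_lambda _ fun j => ?_
    obtain ⟨j, h1, h2⟩ := j
    rw [hq] at h1 h2
    rw [add_mul] at h2
    obtain ⟨s, rfl⟩ := Nat.exists_eq_add_of_le (Nat.le_of_succ_le h1)
    exact hY s (by omega) (by omega)

/-- The transform `(u, v) ↦ (u * v, v)` is invertible, so the data preceding an odd index carry the
same information as the data of the two half blocks. -/
theorem blockSigma_odd [MeasurableMul₂ G] [MeasurableInv G] (h1 : 1 ≤ l) (h2 : l ≤ 2 ^ n) :
    blockSigma X Y (n + 1) q (2 * l - 1) =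
      blockSigma X Y n (2 * q) l ⊔ blockSigma X Y n (2 * q + 1) l := by
  have hp : 2 ^ (n + 1) = 2 ^ n + 2 ^ n := by ring
  apply le_antisymm
  · have hleft : ∀ k, 1 ≤ k → k < l →
        Measurable[blockSigma X Y n (2 * q) l ⊔ blockSigma X Y n (2 * q + 1) l]
          (polarU X n (2 * q * 2 ^ n + k)) := fun k hk hk' =>
      (measurable_polarU_blockSigma hk hk' h2).mono le_sup_left le_rfl
    have hright : ∀ k, 1 ≤ k → k < l →
        Measurable[blockSigma X Y n (2 * q) l ⊔ blockSigma X Y n (2 * q + 1) l]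
          (polarU X n ((2 * q + 1) * 2 ^ n + k)) := fun k hk hk' =>
      (measurable_polarU_blockSigma hk hk' h2).mono le_sup_right le_rfl
    refine blockSigma_le (by omega) (by omega) (fun s hs hs' => ?_) (fun s hs hs' => ?_)
    · obtain ⟨k, hk, hk', rfl | rfl⟩ := exists_odd_or_even (n := n) hs (by omega)
      · rw [polarU_odd X hk hk']
        exact (hleft k hk (by omega)).mul (hright k hk (by omega))
      · rw [polarU_even X hk hk']
        exact hright k hk (by omega)
    · rcases le_or_gt s (2 ^ n) with h | h
      · rw [left_block_index]
        exact (measurable_side_blockSigma hs h h1 h2).mono le_sup_left le_rfl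
      · obtain ⟨k, rfl⟩ := Nat.exists_eq_add_of_le h.le
        rw [add_comm (2 ^ n) k, ← add_assoc, right_block_index]
        exact (measurable_side_blockSigma (by omega) (by omega) h1 h2).mono le_sup_right le_rfl
  · have hright : ∀ k, 1 ≤ k → k < l → Measurable[blockSigma X Y (n + 1) q (2 * l - 1)]
        (polarU X n ((2 * q + 1) * 2 ^ n + k)) := fun k hk hk' => by
      rw [← polarU_even X hk (by omega)]
      exact measurable_polarU_blockSigma (by omega) (by omega) (by omega)
    have hleft : ∀ k, 1 ≤ k → k < l → Measurable[blockSigma X Y (n + 1) q (2 * l - 1)]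
        (polarU X n (2 * q * 2 ^ n + k)) := fun k hk hk' => by
      have hodd : Measurable[blockSigma X Y (n + 1) q (2 * l - 1)]
          (polarU X (n + 1) (q * 2 ^ (n + 1) + (2 * k - 1))) :=
        measurable_polarU_blockSigma (by omega) (by omega) (by omega)
      rw [polarU_odd X hk (by omega)] at hodd
      have := hodd.mul (hright k hk hk').inv
      have e : (fun ω => polarU X n (2 * q * 2 ^ n + k) ω * polarU X n ((2 * q + 1) * 2 ^ n + k) ω) *
          (polarU X n ((2 * q + 1) * 2 ^ n + k))⁻¹ = polarU X n (2 * q * 2 ^ n + k) := by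
        ext ω; simp
      rwa [e] at this
    refine sup_le (blockSigma_le h1 h2 hleft fun s hs hs' => ?_)
      (blockSigma_le h1 h2 hright fun s hs hs' => ?_)
    · rw [← left_block_index]
      exact measurable_side_blockSigma hs (by omega) (by omega) (by omega)
    · rw [← right_block_index, add_assoc]
      exact measurable_side_blockSigma (by omega) (by omega) (by omega) (by omega)

theorem blockSigma_even (h1 : 1 ≤ l) (h2 : l ≤ 2 ^ n) :
    blockSigma X Y (n + 1) q (2 * l) = blockSigma X Y (n + 1) q (2 * l - 1) ⊔
      MeasurableSpace.comap (polarU X (n + 1) (q * 2 ^ (n + 1) + (2 * l - 1))) inferInstance := by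
  have hp : 2 ^ (n + 1) = 2 ^ n + 2 ^ n := by ring
  apply le_antisymm
  · refine blockSigma_le (by omega) (by omega) (fun s hs hs' => ?_) (fun s hs hs' => ?_)
    · rcases eq_or_lt_of_le (show s ≤ 2 * l - 1 by omega) with rfl | h
      · exact (comap_measurable _).mono le_sup_right le_rfl
      · exact (measurable_polarU_blockSigma hs h (by omega)).mono le_sup_left le_rfl
    · exact (measurable_side_blockSigma hs hs' (by omega) (by omega)).mono le_sup_left le_rfl
  · refine sup_le (blockSigma_le (by omega) (by omega) (fun s hs hs' => ?_)
      (fun s hs hs' => ?_)) (Measurable.comap_le ?_)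
    · exact measurable_polarU_blockSigma hs (by omega) (by omega)
    · exact measurable_side_blockSigma hs hs' (by omega) (by omega)
    · exact measurable_polarU_blockSigma (by omega) (by omega) (by omega)

variable (X Y) in
/-- The σ-algebra generated by the pairs `(X j, Y j)` of the block `q` of level `n`. -/
noncomputable abbrev blockField (n q : ℕ) : MeasurableSpace Ω :=
  ⨆ j ∈ {j : {i : ℕ // 1 ≤ i} | q * 2 ^ n < j ∧ (j : ℕ) ≤ (q + 1) * 2 ^ n},
    MeasurableSpace.comap (fun ω => (X j ω, Y j ω)) inferInstance

theorem measurable_pair_blockField (hs : 1 ≤ s) (hs' : s ≤ 2 ^ n) :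
    Measurable[blockField X Y n q] (fun ω => (X (q * 2 ^ n + s) ω, Y (q * 2 ^ n + s) ω)) := by
  refine (comap_measurable _).mono ?_ le_rfl
  refine le_iSup₂_of_le (f := fun (j : {i : ℕ // 1 ≤ i}) (_ : j ∈ {j : {i : ℕ // 1 ≤ i} |
    q * 2 ^ n < j ∧ (j : ℕ) ≤ (q + 1) * 2 ^ n}) =>
      MeasurableSpace.comap (fun ω => (X j ω, Y j ω)) inferInstance)
    ⟨q * 2 ^ n + s, by omega⟩ ?_ le_rfl
  constructor
  · change q * 2 ^ n < q * 2 ^ n + s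
    omega
  · change q * 2 ^ n + s ≤ (q + 1) * 2 ^ n
    rw [add_mul]
    omega

theorem measurable_polarU_blockField [MeasurableMul₂ G] (hr : 1 ≤ r) (hr' : r ≤ 2 ^ n) :
    Measurable[blockField X Y n q] (polarU X n (q * 2 ^ n + r)) :=
  measurable_polarU (mΩ := blockField X Y n q) hr hr' fun _ hs hs' =>
    measurable_fst.comp (measurable_pair_blockField hs hs')

theorem blockSigma_le_blockField [MeasurableMul₂ G] (hr : 1 ≤ r) (hr' : r ≤ 2 ^ n) :
    blockSigma X Y n q r ≤ blockField X Y n q :=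
  blockSigma_le hr hr' (fun _ hs hs' => measurable_polarU_blockField hs (by omega))
    fun _ hs hs' => measurable_snd.comp (measurable_pair_blockField hs hs')

theorem indep_blockField [MeasurableSpace Ω] {μ : Measure Ω}
    (hX : ∀ i, 1 ≤ i → Measurable (X i)) (hY : ∀ i, 1 ≤ i → Measurable (Y i))
    (h_indep : iIndepFun (fun (i : {i : ℕ // 1 ≤ i}) (ω : Ω) => (X i ω, Y i ω)) μ) (n q : ℕ) :
    Indep (blockField X Y n (2 * q)) (blockField X Y n (2 * q + 1)) μ := by
  refine indep_iSup_of_disjoint (m := fun i : {i : ℕ // 1 ≤ i} =>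
    MeasurableSpace.comap (fun ω => (X i ω, Y i ω)) inferInstance)
    (fun i => ((hX i.1 i.2).prodMk (hY i.1 i.2)).comap_le) h_indep ?_
  rw [Set.disjoint_left]
  intro j h1 h2
  exact absurd h1.2 (not_le.2 h2.1)

end BlockSigma

/-! ### The polar transform of erasure distributions -/

section Main

variable {G : Type*} [Group G] [MeasurableSpace G] [StandardBorelSpace G]

section Erasure

variable {Ω : Type*} {m mΩ : MeasurableSpace Ω} {μ : Measure Ω} [IsFiniteMeasure μ] {X : Ω → G}
  {Y : Ω → FiniteCoset G}

theorem IsErasure.hasCondLaw (h : IsErasure μ X Y) :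
    HasCondLaw (MeasurableSpace.comap Y inferInstance) μ Y X (uniformKernel G) :=
  .of_condDistrib h.measurable_side h.measurable_source fun B hB => by
    filter_upwards [h.condDistrib_eq B hB] with ω hω
    rw [hω, uniformKernel_apply, FiniteCoset.uniform_apply _ hB]

theorem HasCondLaw.isErasure
    (h : HasCondLaw m μ Y X (uniformKernel G)) : IsErasure μ X Y where
  measurable_source := h.measurable_source
  measurable_side := h.measurable_left
  condDistrib_eq B hB := by
    have h' := h.mono (m' := MeasurableSpace.comap Y inferInstance)
      h.measurable_param.comap_le (comap_measurable Y)
    filter_upwards [h'.condDistrib_ae_eq hB] with ω hω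
    rw [hω, uniformKernel_apply, FiniteCoset.uniform_apply _ hB]

end Erasure

/-- The kernel that draws a uniformly distributed point of `φ (g, S, T)`. -/
noncomputable def plusKernel (G : Type*) [Group G] [MeasurableSpace G] [StandardBorelSpace G]
    [MeasurableMul₂ G] : Kernel ((FiniteCoset G × FiniteCoset G) × G) G :=
  (uniformKernel G).comap (fun p => FiniteCoset.plus p.2 p.1.1 p.1.2) measurable_plus

instance [MeasurableMul₂ G] : IsMarkovKernel (plusKernel G) :=
  inferInstanceAs (IsMarkovKernel (Kernel.comap _ _ _))

section Step

variable [MeasurableMul₂ G] {Ω : Type*} {m mΩ : MeasurableSpace Ω} {μ : Measure Ω}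
  {U V : Ω → G} {S T : Ω → FiniteCoset G}

theorem HasCondLaw.mul (h : HasCondLaw m μ (fun ω => (S ω, T ω)) (fun ω => (U ω, V ω))
      ((uniformKernel G) ∥ₖ (uniformKernel G))) :
    HasCondLaw m μ (fun ω => (S ω).minus (T ω)) (fun ω => U ω * V ω) (uniformKernel G) := by
  have hm : Measurable fun v : G × G => v.1 * v.2 := measurable_fst.mul measurable_snd
  refine (h.map hm).reparam (f := fun p => FiniteCoset.minus p.1 p.2) measurable_minus fun w => ?_
  rw [Kernel.map_apply _ hm, Kernel.parallelComp_apply, uniformKernel_apply, uniformKernel_apply,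
    uniformKernel_apply, map_mul_uniform]

theorem HasCondLaw.plus [IsFiniteMeasure μ]
    (h : HasCondLaw m μ (fun ω => (S ω, T ω)) (fun ω => (U ω, V ω))
      ((uniformKernel G) ∥ₖ (uniformKernel G))) :
    HasCondLaw (m ⊔ MeasurableSpace.comap (fun ω => U ω * V ω) inferInstance) μ
      (fun ω => FiniteCoset.plus (U ω * V ω) (S ω) (T ω)) V (uniformKernel G) := by
  have hm : Measurable fun v : G × G => v.1 * v.2 := measurable_fst.mul measurable_snd
  have hζ : ∀ w : FiniteCoset G × FiniteCoset G, ∀ C : Set G, MeasurableSet C → ∀ B : Set G,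
      MeasurableSet B → ((uniformKernel G) ∥ₖ (uniformKernel G)) w
          ((fun v => v.1 * v.2) ⁻¹' C ∩ Prod.snd ⁻¹' B) =
        ∫⁻ v in (fun v => v.1 * v.2) ⁻¹' C, plusKernel G (w, v.1 * v.2) B
          ∂(((uniformKernel G) ∥ₖ (uniformKernel G)) w) := by
    intro w C hC B hB
    simp only [Kernel.parallelComp_apply, uniformKernel_apply, plusKernel, Kernel.comap_apply]
    exact uniform_prod_disintegrate w.1 w.2 hC hB (measurable_plus_left w.1 w.2)
  have hd := h.disintegrate (ζ := plusKernel G) hm measurable_snd hζ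
  exact hd.reparam (f := fun p => FiniteCoset.plus p.2 p.1.1 p.1.2) (η' := uniformKernel G)
    measurable_plus fun _ => rfl

end Step

variable [MeasurableMul₂ G] [MeasurableInv G] {Ω : Type*} [MeasurableSpace Ω] {μ : Measure Ω}
  [IsProbabilityMeasure μ] {X : ℕ → Ω → G} {Y : ℕ → Ω → FiniteCoset G}

/-- The invariant of the recursion: given all its conditioning data, the transformed variable is
uniform on the transformed coset. -/
theorem hasCondLaw_polar (h_erasure : ∀ i : ℕ, 1 ≤ i → IsErasure μ (X i) (Y i))
    (h_indep : iIndepFun (fun (i : {i : ℕ // 1 ≤ i}) (ω : Ω) => (X i ω, Y i ω)) μ) (n : ℕ) :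
    ∀ q r, 1 ≤ r → r ≤ 2 ^ n → HasCondLaw (blockSigma X Y n q r) μ
      (polarY X Y n (q * 2 ^ n + r)) (polarU X n (q * 2 ^ n + r)) (uniformKernel G) := by
  induction n with
  | zero =>
    intro q r h1 h2
    have hr : 1 ≤ q * 2 ^ 0 + r := by omega
    refine (h_erasure _ hr).hasCondLaw.mono ?_ (measurable_side_blockSigma h1 h2 h1 h2)
    refine blockSigma_le h1 h2 (fun s hs hs' => ?_) (fun s hs hs' => ?_)
    · rw [pow_zero] at h2
      omega
    · obtain rfl : s = r := by rw [pow_zero] at h2 hs'; omega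
      exact comap_measurable _
  | succ n ih =>
    intro q r hr hr'
    obtain ⟨l, h1, h2, hl⟩ := exists_odd_or_even hr hr'
    have joint := (ih (2 * q) l h1 h2).prod (ih (2 * q + 1) l h1 h2)
      (blockSigma_le_blockField h1 h2) (blockSigma_le_blockField h1 h2)
      (measurable_polarU_blockField h1 h2) (measurable_polarU_blockField h1 h2)
      (indep_blockField (fun i hi => (h_erasure i hi).measurable_source)
        (fun i hi => (h_erasure i hi).measurable_side) h_indep n q)
    rcases hl with rfl | rfl
    · rw [blockSigma_odd h1 h2, polarU_odd X h1 h2, polarY_odd X Y h1 h2]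
      exact joint.mul
    · rw [blockSigma_even h1 h2, blockSigma_odd h1 h2, polarU_odd X h1 h2, polarU_even X h1 h2,
        polarY_even X Y h1 h2]
      exact joint.plus

end Main

end PolarErasure

theorem theorem1 {G : Type*} [Group G] [TopologicalSpace G] [IsTopologicalGroup G] [PolishSpace G]
    [MeasurableSpace G] [BorelSpace G]
    {Ω : Type*} [MeasurableSpace Ω] (μ : Measure Ω) [IsProbabilityMeasure μ]
    (X : ℕ → Ω → G) (Y : ℕ → Ω → PolarErasure.FiniteCoset G)
    (h_erasure : ∀ i : ℕ, 1 ≤ i → PolarErasure.IsErasure μ (X i) (Y i))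
    (h_indep : iIndepFun (fun (i : {i : ℕ // 1 ≤ i}) (ω : Ω) => (X i ω, Y i ω)) μ) :
    ∀ n i : ℕ, 1 ≤ i →
      PolarErasure.IsErasure μ (PolarErasure.polarU X n i) (PolarErasure.polarY X Y n i) ∧
      PolarErasure.CondEquiv μ (PolarErasure.polarU X n i) (PolarErasure.polarY X Y n i)
        (PolarErasure.blockData X Y n i) := by
  intro n i hi
  obtain ⟨q, r, h1, h2, rfl⟩ := PolarErasure.exists_eq_block n hi
  have h := PolarErasure.hasCondLaw_polar h_erasure h_indep n q r h1 h2
  refine ⟨h.isErasure, h.measurable_source, h.measurable_left,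
    fun s hs => h.le _ ⟨s, hs, rfl⟩, fun B hB => ?_⟩
  have h' := h.mono h.measurable_param.comap_le (comap_measurable _)
  filter_upwards [h'.condDistrib_ae_eq hB, h.condDistrib_ae_eq hB] with ω hY hD
  rw [hY, hD]
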